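/- Let $\mathcal{F}$ be a many-sorted signature (symbols $f : S_1\times\cdots\times S_n\to S$), let $\mathcal{F}_{\mathsf{AC}}\subseteq\mathcal{F}$ be a set of binary symbols with sort declarations of the form $S\times S\to S$, and consider the well-sorted terms over $\mathcal{F}$ and sorted variables $\mathcal{V}$. Let $=_{\mathsf{AC}}$ be the reflexive, symmetric and transitive closure of rewriting with the equations $f(f(x,y),z)\approx f(x,f(y,z))$ and $f(x,y)\approx f(y,x)$ for $f\in\mathcal{F}_{\mathsf{AC}}$, and let $=_{\mathsf{AC}}^{\mathrm{mul}}$ be its extension to finite multisets (elementwise matching modulo $=_{\mathsf{AC}}$). For a term $t=f(t_1,\dots,t_n)$ put $\triangledown(t)=\triangledown_f(t_1)\uplus\cdots\uplus\triangledown_f(t_n)$, where $\triangledown_f(u)=\triangledown_f(u_1)\uplus\triangledown_f(u_2)$ if $f\in\mathcal{F}_{\mathsf{AC}}$ and $u=f(u_1,u_2)$, and $\triangledown_f(u)=\{u\}$ otherwise. For a relation $\succ$ on terms, write $M\succ^{\mathrm{mul}}N$ if $M=S_1\uplus S_2$ and $N=T_1\uplus T_2$ for some multisets with $S_1=_{\mathsf{AC}}^{\mathrm{mul}}T_1$,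 $S_2\neq\varnothing$, and for every $t'\in T_2$ there is $s'\in S_2$ with $s'\succ t'$; and let $\succcurlyeq^{\mathrm{mul}}$ be the union of $\succ^{\mathrm{mul}}$ and $=_{\mathsf{AC}}^{\mathrm{mul}}$. A precedence is a strict order $>$ on $\mathcal{F}$. For a precedence $>$, AC-MPO is the inductively defined (least) relation $>_{\mathsf{acmpo}}$ on terms (of possibly different sorts) such that $s>_{\mathsf{acmpo}}t$ if $s\notin\mathcal{V}$ and one of the following holds: 1. $\triangledown(s)\geqslant_{\mathsf{acmpo}}^{\mathrm{mul}}\{t\}$; 2. $t\notin\mathcal{V}$, $\mathrm{root}(s)>\mathrm{root}(t)$ and $\{s\}>_{\mathsf{acmpo}}^{\mathrm{mul}}\triangledown(t)$; 3. $t\notin\mathcal{V}$, $\mathrm{root}(s)=\mathrm{root}(t)$ and $\triangledown(s)>_{\mathsf{acmpo}}^{\mathrm{mul}}\triangledown(t)$. **Theorem.** Suppose that every AC symbol is minimal in the precedence $>$, i.e. there are no $f\in\mathcal{F}_{\mathsf{AC}}$ and $g\in\mathcal{F}$ with $f>g$. Then: (a) $>_{\mathsf{acmpo}}$ is a rewrite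 order, i.e. it is irreflexive, transitive, closed under contexts ($s>_{\mathsf{acmpo}}t$ implies $C[s]>_{\mathsf{acmpo}}C[t]$ whenever $s$, $t$ and the hole of the one-hole context $C$ have the same sort) and closed under (sort-preserving, finite-domain) substitutions; (b) $>_{\mathsf{acmpo}}$ is AC-compatible: ${=_{\mathsf{AC}}}\cdot{>_{\mathsf{acmpo}}}\cdot{=_{\mathsf{AC}}}\subseteq{>_{\mathsf{acmpo}}}$; (c) $>_{\mathsf{acmpo}}$ has the subterm property: $s>_{\mathsf{acmpo}}t$ whenever $t$ is a proper subterm of $s$; (d) AC-MPO is incremental: for every precedence $\sqsupset$ with ${>}\subseteq{\sqsupset}$ we have ${>_{\mathsf{acmpo}}}\subseteq{\sqsupset_{\mathsf{acmpo}}}$. -/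

import Mathlib

namespace ACRew

universe u v w

/-- A many-sorted signature over the sorts `S`, with a distinguished set of AC symbols. The symbol
`f` has the sort declaration `dom f 0 × ⋯ × dom f (arity f - 1) → cod f`. Every AC symbol is binary
with a sort declaration of the form `A × A → A`. -/
structure Signature (S : Type u) where
  Sym : Type v
  arity : Sym → ℕ
  dom : (f : Sym) → Fin (arity f) → S
  cod : Sym → S
  AC : Set Sym
  ac_arity : ∀ f ∈ AC, arity f = 2
  ac_dom : ∀ f ∈ AC, ∀ i, dom f i = cod f

variable {S : Type u}

/-- Well-sorted terms, indexed by their sort; `V s` is the set of variables of sort `s`. -/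
inductive Term (F : Signature.{u, v} S) (V : S → Type w) : S → Type (max u v w)
  | var {s : S} (x : V s) : Term F V s
  | app (f : F.Sym) (args : (i : Fin (F.arity f)) → Term F V (F.dom f i)) : Term F V (F.cod f)

/-- Terms of arbitrary sort. -/
abbrev AnyTerm (F : Signature.{u, v} S) (V : S → Type w) : Type (max u v w) :=
  (s : S) × Term F V s

/-- A term `t` of sort `s`, seen as a term of arbitrary sort. -/
abbrev Term.any {F : Signature.{u, v} S} {V : S → Type w} {s : S} (t : Term F V s) :
    AnyTerm F V :=
  ⟨s, t⟩

/-- `Ctx F V s s'`: terms of sort `s'` with exactly one occurrence of the hole of sort `s`. -/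
inductive Ctx (F : Signature.{u, v} S) (V : S → Type w) (s : S) : S → Type (max u v w)
  | hole : Ctx F V s s
  | app (f : F.Sym) (i : Fin (F.arity f))
      (args : (j : Fin (F.arity f)) → j ≠ i → Term F V (F.dom f j))
      (C : Ctx F V s (F.dom f i)) : Ctx F V s (F.cod f)

/-- `C.fill t` is `C[t]`, the result of replacing the hole of `C` by `t`. -/
def Ctx.fill {F : Signature.{u, v} S} {V : S → Type w} {s : S} :
    {s' : S} → Ctx F V s s' → Term F V s → Term F V s'
  | _, .hole, t => t
  | _, .app f i args C, t =>
      .app f (fun j => if h : j = i then h ▸ C.fill t else args j h)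

/-- A substitution: a sort-preserving map from variables to terms with finite domain. -/
structure Substitution (F : Signature.{u, v} S) (V : S → Type w) where
  toFun : (s : S) → V s → Term F V s
  finite_domain : {x : (s : S) × V s | toFun x.1 x.2 ≠ .var x.2}.Finite

/-- Application of a substitution to a term. -/
def Term.subst {F : Signature.{u, v} S} {V : S → Type w} (σ : Substitution F V) :
    {s : S} → Term F V s → Term F V s
  | s, .var x => σ.toFun s x
  | _, .app f args => .app f (fun i => (args i).subst σ)

section Relations

variable {F : Signature.{u, v} S} {V : S → Type w}

def ClosedUnderContexts (R : AnyTerm F V → AnyTerm F V → Prop) : Prop :=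
  ∀ (s s' : S) (C : Ctx F V s s') (a b : Term F V s),
    R a.any b.any → R (C.fill a).any (C.fill b).any

def ClosedUnderSubstitutions (R : AnyTerm F V → AnyTerm F V → Prop) : Prop :=
  ∀ (σ : Substitution F V) (s s' : S) (a : Term F V s) (b : Term F V s'),
    R a.any b.any → R (a.subst σ).any (b.subst σ).any

/-- A rewrite order: a strict order closed under contexts and substitutions. -/
structure IsRewriteOrder (R : AnyTerm F V → AnyTerm F V → Prop) : Prop where
  irrefl : ∀ a, ¬ R a a
  trans : ∀ a b c, R a b → R b c → R a c
  closedUnderContexts : ClosedUnderContexts R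
  closedUnderSubstitutions : ClosedUnderSubstitutions R

/-- `ImmediateSubterm t u`: `u` is one of the arguments of `t = f(t₁, …, tₙ)`. -/
inductive ImmediateSubterm : AnyTerm F V → AnyTerm F V → Prop
  | arg (f : F.Sym) (args : (i : Fin (F.arity f)) → Term F V (F.dom f i))
      (i : Fin (F.arity f)) : ImmediateSubterm (Term.app f args).any (args i).any

/-- `R` contains the proper superterm relation. -/
def HasSubtermProperty (R : AnyTerm F V → AnyTerm F V → Prop) : Prop :=
  ∀ t u, Relation.TransGen ImmediateSubterm t u → R t u

/-- The term `f(a, b)` for an AC symbol `f`. -/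
def acApp (f : F.Sym) (hf : f ∈ F.AC) (a b : Term F V (F.cod f)) : Term F V (F.cod f) :=
  .app f (fun i => (F.ac_dom f hf i).symm ▸ (if (i : ℕ) = 0 then a else b))

/-- Substitution instances of the equations `f(f(x,y),z) ≈ f(x,f(y,z))` and `f(x,y) ≈ f(y,x)`,
for the AC symbols `f`. -/
inductive ACInstance : {s : S} → Term F V s → Term F V s → Prop
  | assoc (f : F.Sym) (hf : f ∈ F.AC) (a b c : Term F V (F.cod f)) :
      ACInstance (acApp f hf (acApp f hf a b) c) (acApp f hf a (acApp f hf b c))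
  | comm (f : F.Sym) (hf : f ∈ F.AC) (a b : Term F V (F.cod f)) :
      ACInstance (acApp f hf a b) (acApp f hf b a)

/-- The rewrite relation `→_AC`: an AC equation is applied inside a context. -/
inductive ACStep : AnyTerm F V → AnyTerm F V → Prop
  | mk {s s' : S} (C : Ctx F V s s') (a b : Term F V s) (h : ACInstance a b) :
      ACStep (C.fill a).any (C.fill b).any

/-- `=_AC`: the reflexive, transitive and symmetric closure of `→_AC`. -/
def ACEq : AnyTerm F V → AnyTerm F V → Prop :=
  Relation.EqvGen ACStep

/-- `=_AC · R · =_AC ⊆ R`. -/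
def IsACCompatible (R : AnyTerm F V → AnyTerm F V → Prop) : Prop :=
  ∀ s s' t' t, ACEq s s' → R s' t' → ACEq t' t → R s t

open Classical in
/-- Flattening `▽_f(t)` of a term with respect to a symbol `f`: if `f` is an AC symbol and
`t = f(t₁, t₂)` then it is `▽_f(t₁) ⊎ ▽_f(t₂)`, otherwise it is `{t}`. -/
noncomputable def flat (f : F.Sym) : {s : S} → Term F V s → Multiset (AnyTerm F V)
  | _, .var x => {(Term.var x).any}
  | _, .app g args =>
      if g = f ∧ f ∈ F.AC then ∑ i, flat f (args i) else {(Term.app g args).any}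

/-- `▽(f(t₁, …, tₙ)) = ▽_f(t₁) ⊎ ⋯ ⊎ ▽_f(tₙ)`. -/
noncomputable def topFlat (f : F.Sym) (args : (i : Fin (F.arity f)) → Term F V (F.dom f i)) :
    Multiset (AnyTerm F V) :=
  ∑ i, flat f (args i)

/-- The multiset extension of `R` modulo AC. `Multiset.Rel ACEq` is the multiset extension of
`=_AC`. -/
def MulExt (R : AnyTerm F V → AnyTerm F V → Prop) (M N : Multiset (AnyTerm F V)) : Prop :=
  ∃ S₁ S₂ T₁ T₂ : Multiset (AnyTerm F V), M = S₁ + S₂ ∧ N = T₁ + T₂ ∧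
    Multiset.Rel ACEq S₁ T₁ ∧ S₂ ≠ 0 ∧ ∀ t' ∈ T₂, ∃ s' ∈ S₂, R s' t'

/-- The reflexive version of `MulExt`. -/
def MulExtEq (R : AnyTerm F V → AnyTerm F V → Prop) (M N : Multiset (AnyTerm F V)) : Prop :=
  MulExt R M N ∨ Multiset.Rel ACEq M N

/-- The three cases of the definition of AC-MPO for the precedence `gt`, where `R` is used for the
recursive comparisons. The left-hand side is never a variable. -/
inductive ACMPOStep (gt : F.Sym → F.Sym → Prop) (R : AnyTerm F V → AnyTerm F V → Prop) :
    AnyTerm F V → AnyTerm F V → Prop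
  | subterm (f : F.Sym) (ss : (i : Fin (F.arity f)) → Term F V (F.dom f i)) (t : AnyTerm F V)
      (h : MulExtEq R (topFlat f ss) {t}) :
      ACMPOStep gt R (Term.app f ss).any t
  | prec (f g : F.Sym) (ss : (i : Fin (F.arity f)) → Term F V (F.dom f i))
      (ts : (i : Fin (F.arity g)) → Term F V (F.dom g i))
      (hfg : gt f g) (h : MulExt R {(Term.app f ss).any} (topFlat g ts)) :
      ACMPOStep gt R (Term.app f ss).any (Term.app g ts).any
  | root (f : F.Sym) (ss ts : (i : Fin (F.arity f)) → Term F V (F.dom f i))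
      (h : MulExt R (topFlat f ss) (topFlat f ts)) :
      ACMPOStep gt R (Term.app f ss).any (Term.app f ts).any

theorem MulExt.mono {R R' : AnyTerm F V → AnyTerm F V → Prop} (hR : R ≤ R')
    {M N : Multiset (AnyTerm F V)} (h : MulExt R M N) : MulExt R' M N := by
  obtain ⟨S₁, S₂, T₁, T₂, hM, hN, h₁, h₂, h₃⟩ := h
  refine ⟨S₁, S₂, T₁, T₂, hM, hN, h₁, h₂, fun t' ht' => ?_⟩
  obtain ⟨s', hs', hst⟩ := h₃ t' ht'
  exact ⟨s', hs', hR _ _ hst⟩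

theorem ACMPOStep.monotone (gt : F.Sym → F.Sym → Prop) :
    Monotone (ACMPOStep (V := V) gt) := by
  intro R R' hR s t h
  cases h with
  | subterm f ss t h => exact .subterm f ss t (h.imp (MulExt.mono hR) id)
  | prec f g ss ts hfg h => exact .prec f g ss ts hfg (h.mono hR)
  | root f ss ts h => exact .root f ss ts (h.mono hR)

/-- AC-MPO for the precedence `gt`: the least relation closed under the three cases. -/
def ACMPO (gt : F.Sym → F.Sym → Prop) : AnyTerm F V → AnyTerm F V → Prop :=
  OrderHom.lfp ⟨ACMPOStep gt, ACMPOStep.monotone gt⟩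

end Relations

end ACRew

/-!
AC-MPO inspects a term only through its root symbol and its multiset `▽(t)` of top-level arguments,
and `=_AC` preserves the root and, up to `=_AC`, the multiset `▽(t)` (`ACEq.root_topArgs`). Hence
the case distinction in the definition can be phrased with `root` and `topArgs` alone
(`acmpo_iff`), and the order-theoretic part of the proof does not mention argument tuples.

AC-compatibility (`isACCompatible_acmpo`) is an induction on the derivation. Transitivity
(`ACMPO.trans`) is an induction on the sum of the sizes of the three terms, since the multiset
extension is transitive as soon as the relation is so on the elements of the multisets
(`MulExt.trans`). Irreflexivity (`ACMPO.irrefl`) is an induction on the size: a multiset that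
dominates itself would, after cancellation modulo `=_AC`, contain a nonempty finite part without a
maximal element (`MulExt.irrefl`), and a term is never AC-equal to one of its top-level arguments
(`not_acEq_of_mem_topArgs`). For the subterm property, an immediate subterm either is a top-level
argument, or it has the same AC root and lacks the arguments that stem from its sibling.

The key to closure under contexts is that `s > t` makes the flattening of `s` greater than that of
`t` in the multiset extension (`ACMPO.mulExt_flat`). If the root of `s` is the AC symbol in
question, this uses that AC symbols are minimal in the precedence, and that `s` has at least two
top-level arguments. Closure under substitutions is an induction on the derivation.
-/

namespace ACRew

universe u v w

variable {S : Type u} {F : Signature.{u, v} S} {V : S → Type w}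

/-! ### Roots, top-level arguments and subterms -/

/-- The root symbol of a term; variables have none. -/
def root : AnyTerm F V → Option F.Sym
  | ⟨_, .var _⟩ => none
  | ⟨_, .app f _⟩ => some f

/-- The multiset `▽(t)`, as a function on all terms; it is empty on variables. -/
noncomputable def topArgs : AnyTerm F V → Multiset (AnyTerm F V)
  | ⟨_, .var _⟩ => 0
  | ⟨_, .app f ss⟩ => topFlat f ss

/-- The number of variable and symbol occurrences of a term. -/
def Term.size : {s : S} → Term F V s → ℕ
  | _, .var _ => 1
  | _, .app _ args => 1 + ∑ i, (args i).size

theorem size_lt_of_immediateSubterm {t u : AnyTerm F V} (h : ImmediateSubterm t u) :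
    u.2.size < t.2.size := by
  obtain ⟨f, args, i⟩ := h
  have := Finset.single_le_sum (f := fun i => (args i).size) (fun _ _ => Nat.zero_le _)
    (Finset.mem_univ i)
  simp only [Term.size] at this ⊢
  omega

theorem size_lt_of_subterm {t u : AnyTerm F V} (h : Relation.TransGen ImmediateSubterm t u) :
    u.2.size < t.2.size := by
  induction h with
  | single h => exact size_lt_of_immediateSubterm h
  | tail _ h ih => exact (size_lt_of_immediateSubterm h).trans ih

theorem flat_eq_topArgs {f : F.Sym} (hf : f ∈ F.AC) {t : AnyTerm F V} (ht : root t = some f) :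
    flat f t.2 = topArgs t := by
  obtain ⟨_, x | ⟨g, args⟩⟩ := t
  · cases ht
  · obtain rfl : g = f := Option.some.inj ht
    simp only [flat, topArgs, topFlat]
    exact if_pos ⟨rfl, hf⟩

theorem flat_eq_singleton {f : F.Sym} {t : AnyTerm F V} (h : ¬ (root t = some f ∧ f ∈ F.AC)) :
    flat f t.2 = {t} := by
  obtain ⟨_, x | ⟨g, args⟩⟩ := t
  · simp [flat]
  · simp only [flat]
    exact if_neg fun h' => h ⟨congrArg some h'.1, h'.2⟩

theorem subterm_of_mem_flat {f : F.Sym} {s : S} {t : Term F V s} {x : AnyTerm F V}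
    (h : x ∈ flat f t) : Relation.ReflTransGen ImmediateSubterm t.any x := by
  induction t with
  | var y =>
    rw [flat, Multiset.mem_singleton] at h
    exact h ▸ .refl
  | app g args ih =>
    rw [flat] at h
    split_ifs at h with hg
    · obtain ⟨i, -, hi⟩ := Multiset.mem_sum.1 h
      exact .head (.arg g args i) (ih i hi)
    · rw [Multiset.mem_singleton] at h
      exact h ▸ .refl

theorem subterm_of_mem_topArgs {t x : AnyTerm F V} (h : x ∈ topArgs t) :
    Relation.TransGen ImmediateSubterm t x := by
  obtain ⟨_, y | ⟨g, args⟩⟩ := t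
  · simp [topArgs] at h
  · obtain ⟨i, -, hi⟩ := Multiset.mem_sum.1 (show x ∈ topFlat g args from h)
    exact .head' (.arg g args i) (subterm_of_mem_flat hi)

theorem size_lt_of_mem_topArgs {t x : AnyTerm F V} (h : x ∈ topArgs t) :
    x.2.size < t.2.size :=
  size_lt_of_subterm (subterm_of_mem_topArgs h)

theorem flat_ne_zero (f : F.Sym) {s : S} (t : Term F V s) : flat f t ≠ 0 := by
  induction t with
  | var y => simp [flat]
  | app g args ih =>
    rw [flat]
    split_ifs with h
    · have h0 : 0 < F.arity g := by rw [F.ac_arity g (h.1 ▸ h.2)]; exact Nat.two_pos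
      intro h'
      exact ih ⟨0, h0⟩ (Finset.sum_eq_zero_iff.1 h' _ (Finset.mem_univ _))
    · simp

theorem two_le_card_topArgs {f : F.Sym} (hf : f ∈ F.AC) {t : AnyTerm F V}
    (ht : root t = some f) : 2 ≤ (topArgs t).card := by
  obtain ⟨_, x | ⟨g, args⟩⟩ := t
  · cases ht
  · obtain rfl : g = f := Option.some.inj ht
    have := Finset.card_nsmul_le_sum Finset.univ (fun i => (flat g (args i)).card) 1
      fun i _ => Multiset.card_pos.2 (flat_ne_zero g (args i))
    simpa [topArgs, topFlat, F.ac_arity g hf] using this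

/-- The elements of a flattening are themselves flat. -/
theorem flat_of_mem_flat {f : F.Sym} {s : S} {t : Term F V s} {x : AnyTerm F V}
    (h : x ∈ flat f t) : flat f x.2 = {x} := by
  induction t with
  | var y =>
    rw [flat, Multiset.mem_singleton] at h
    subst h
    rw [flat]
  | app g args ih =>
    rw [flat] at h
    split_ifs at h with hg
    · obtain ⟨i, -, hi⟩ := Multiset.mem_sum.1 h
      exact ih i hi
    · rw [Multiset.mem_singleton] at h
      subst h
      rw [flat, if_neg hg]

theorem flat_of_mem_topArgs {f : F.Sym} {t x : AnyTerm F V} (ht : root t = some f)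
    (h : x ∈ topArgs t) : flat f x.2 = {x} := by
  obtain ⟨_, y | ⟨g, args⟩⟩ := t
  · cases ht
  · obtain rfl : g = f := Option.some.inj ht
    obtain ⟨i, -, hi⟩ := Multiset.mem_sum.1 (show x ∈ topFlat g args from h)
    exact flat_of_mem_flat hi

/-- If the flattening of a term is trivial, its root is not the AC symbol in question. -/
theorem not_root_of_flat_eq_singleton {f : F.Sym} {t : AnyTerm F V} (h : flat f t.2 = {t}) :
    ¬ (root t = some f ∧ f ∈ F.AC) := by
  rintro ⟨hr, hf⟩
  have := two_le_card_topArgs hf hr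
  rw [← flat_eq_topArgs hf hr, h, Multiset.card_singleton] at this
  omega

/-! ### Equality modulo AC -/

theorem ACEq.refl (t : AnyTerm F V) : ACEq t t := Relation.EqvGen.refl t

theorem ACEq.symm {s t : AnyTerm F V} (h : ACEq s t) : ACEq t s := Relation.EqvGen.symm _ _ h

theorem ACEq.trans {s t u : AnyTerm F V} (h : ACEq s t) (h' : ACEq t u) : ACEq s u :=
  Relation.EqvGen.trans _ _ _ h h'

theorem rel_refl (M : Multiset (AnyTerm F V)) : Multiset.Rel ACEq M M :=
  Multiset.rel_refl_of_refl_on fun t _ => ACEq.refl t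

theorem rel_symm {M N : Multiset (AnyTerm F V)} (h : Multiset.Rel ACEq M N) :
    Multiset.Rel ACEq N M :=
  Multiset.rel_flip.1 (h.mono fun _ _ _ _ h => h.symm)

theorem rel_trans {M N P : Multiset (AnyTerm F V)} (h : Multiset.Rel ACEq M N)
    (h' : Multiset.Rel ACEq N P) : Multiset.Rel ACEq M P := by
  have : IsTrans (AnyTerm F V) ACEq := ⟨fun _ _ _ => ACEq.trans⟩
  exact Multiset.Rel.trans _ h h'

theorem rel_sum {ι : Type*} (s : Finset ι) (M N : ι → Multiset (AnyTerm F V))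
    (h : ∀ i ∈ s, Multiset.Rel ACEq (M i) (N i)) :
    Multiset.Rel ACEq (∑ i ∈ s, M i) (∑ i ∈ s, N i) := by
  classical
  induction s using Finset.induction_on with
  | empty => simp
  | insert a s ha ih =>
    rw [Finset.sum_insert ha, Finset.sum_insert ha]
    exact (h a (Finset.mem_insert_self a s)).add
      (ih fun i hi => h i (Finset.mem_insert_of_mem hi))

theorem flat_cast (f : F.Sym) {s s' : S} (h : s = s') (t : Term F V s) :
    flat f (h ▸ t) = flat f t := by
  subst h; rfl

theorem topArgs_acApp (f : F.Sym) (hf : f ∈ F.AC) (a b : Term F V (F.cod f)) :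
    topArgs (acApp f hf a b).any = flat f a + flat f b := by
  have key : ∀ n, n = 2 → ∀ A B : Multiset (AnyTerm F V),
      (∑ i : Fin n, if (i : ℕ) = 0 then A else B) = A + B := by
    rintro n rfl A B
    simp
  simp only [topArgs, acApp, topFlat, flat_cast, apply_ite (flat f)]
  exact key _ (F.ac_arity f hf) _ _

theorem flat_acApp (f : F.Sym) (hf : f ∈ F.AC) (a b : Term F V (F.cod f)) :
    flat f (acApp f hf a b) = flat f a + flat f b := by
  rw [← topArgs_acApp f hf]
  exact flat_eq_topArgs (t := (acApp f hf a b).any) hf rfl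

theorem ACInstance.root_topArgs {s : S} {a b : Term F V s} (h : ACInstance a b) :
    ∃ f ∈ F.AC, root a.any = some f ∧ root b.any = some f ∧ topArgs a.any = topArgs b.any := by
  cases h with
  | assoc f hf a b c =>
    refine ⟨f, hf, rfl, rfl, ?_⟩
    simp only [topArgs_acApp, flat_acApp, add_assoc]
  | comm f hf a b =>
    refine ⟨f, hf, rfl, rfl, ?_⟩
    simp only [topArgs_acApp, add_comm]

/-- Replacing one argument by one with an AC-equal flattening. The summands have the shape that
`Ctx.fill` unfolds to. -/
theorem rel_sum_flat_fill (f g : F.Sym) {s : S} (i : Fin (F.arity f))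
    (args : (j : Fin (F.arity f)) → j ≠ i → Term F V (F.dom f j)) (C : Ctx F V s (F.dom f i))
    (a b : Term F V s) (h : Multiset.Rel ACEq (flat g (C.fill a)) (flat g (C.fill b))) :
    Multiset.Rel ACEq
      (∑ j, flat g (if h : j = i then h ▸ C.fill a else args j h : Term F V (F.dom f j)))
      (∑ j, flat g (if h : j = i then h ▸ C.fill b else args j h : Term F V (F.dom f j))) := by
  refine rel_sum _ _ _ fun j _ => ?_
  by_cases hj : j = i
  · subst hj
    simpa using h
  · simpa [hj] using rel_refl _

theorem rel_singleton {s t : AnyTerm F V} (h : ACEq s t) : Multiset.Rel ACEq {s} {t} :=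
  Multiset.rel_cons_left.2 ⟨t, 0, h, .zero, rfl⟩

theorem rel_flat_fill (f : F.Sym) {s s' : S} (C : Ctx F V s s') {a b : Term F V s}
    (h : ACInstance a b) : Multiset.Rel ACEq (flat f (C.fill a)) (flat f (C.fill b)) := by
  have hC : ACEq (C.fill a).any (C.fill b).any := .rel _ _ ⟨C, a, b, h⟩
  induction C with
  | hole =>
    obtain ⟨g, hg, ha, hb, hab⟩ := h.root_topArgs
    simp only [Ctx.fill] at hC ⊢
    by_cases hgf : g = f
    · subst hgf
      rw [show flat g a = topArgs a.any from flat_eq_topArgs hg ha,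
        show flat g b = topArgs b.any from flat_eq_topArgs hg hb, hab]
      exact rel_refl _
    · have hne : ∀ {c : Term F V s}, root c.any = some g → flat f c = {c.any} := fun hc =>
        flat_eq_singleton (t := Term.any _) fun h' =>
          hgf (Option.some.inj (hc.symm.trans h'.1))
      rw [hne ha, hne hb]
      exact rel_singleton hC
  | app g i args C ih =>
    simp only [Ctx.fill, flat]
    split_ifs with hg
    · exact rel_sum_flat_fill _ _ _ _ _ _ _ (ih (.rel _ _ ⟨C, a, b, h⟩))
    · exact rel_singleton hC

/-- The invariant by which `=_AC` is analysed: it preserves the root, and the top-level arguments up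
to `=_AC`. -/
theorem ACEq.root_topArgs {s t : AnyTerm F V} (h : ACEq s t) :
    root s = root t ∧ Multiset.Rel ACEq (topArgs s) (topArgs t) := by
  induction h with
  | rel s t h =>
    obtain ⟨C, a, b, h⟩ := h
    cases C with
    | hole =>
      obtain ⟨f, -, ha, hb, hab⟩ := h.root_topArgs
      simp only [Ctx.fill]
      exact ⟨ha.trans hb.symm, hab ▸ rel_refl _⟩
    | app f i args C =>
      exact ⟨rfl, rel_sum_flat_fill _ _ _ _ _ _ _ (rel_flat_fill f C h)⟩
  | refl t => exact ⟨rfl, rel_refl _⟩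
  | symm s t _ ih => exact ⟨ih.1.symm, rel_symm ih.2⟩
  | trans s t u _ _ ih ih' => exact ⟨ih.1.trans ih'.1, rel_trans ih.2 ih'.2⟩

theorem ACEq.rel_flat (f : F.Sym) {s t : AnyTerm F V} (h : ACEq s t) :
    Multiset.Rel ACEq (flat f s.2) (flat f t.2) := by
  by_cases hs : root s = some f ∧ f ∈ F.AC
  · rw [flat_eq_topArgs hs.2 hs.1, flat_eq_topArgs hs.2 (h.root_topArgs.1 ▸ hs.1)]
    exact h.root_topArgs.2
  · rw [flat_eq_singleton hs, flat_eq_singleton (h.root_topArgs.1 ▸ hs)]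
    exact rel_singleton h

theorem rel_exists_of_mem_right {M N : Multiset (AnyTerm F V)} (h : Multiset.Rel ACEq M N)
    {y : AnyTerm F V} (hy : y ∈ N) : ∃ x ∈ M, ACEq x y := by
  obtain ⟨x, hx, h⟩ := Multiset.exists_mem_of_rel_of_mem (rel_symm h) hy
  exact ⟨x, hx, h.symm⟩

/-- No term is AC-equal to one of its top-level arguments. -/
theorem not_acEq_of_mem_topArgs {t x : AnyTerm F V} (hx : x ∈ topArgs t) : ¬ ACEq x t := by
  induction hn : t.2.size using Nat.strong_induction_on generalizing t x with
  | _ n ih =>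
    subst hn
    intro h
    -- `x` is also, up to AC, a top-level argument of itself.
    obtain ⟨y, hy, hyx⟩ := rel_exists_of_mem_right h.root_topArgs.2 hx
    exact ih _ (size_lt_of_mem_topArgs hx) hy rfl hyx

/-! ### The multiset extension modulo AC -/

theorem MulExt.exists_dominating {R : AnyTerm F V → AnyTerm F V → Prop}
    {M N : Multiset (AnyTerm F V)} (h : MulExt R M N) {y : AnyTerm F V} (hy : y ∈ N) :
    ∃ x ∈ M, R x y ∨ ACEq x y := by
  obtain ⟨S₁, S₂, T₁, T₂, rfl, rfl, h₁, -, h₂⟩ := h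
  rcases Multiset.mem_add.1 hy with hy | hy
  · obtain ⟨x, hx, hxy⟩ := rel_exists_of_mem_right h₁ hy
    exact ⟨x, Multiset.mem_add.2 (.inl hx), .inr hxy⟩
  · obtain ⟨x, hx, hxy⟩ := h₂ y hy
    exact ⟨x, Multiset.mem_add.2 (.inr hx), .inl hxy⟩

theorem MulExt.of_forall {R : AnyTerm F V → AnyTerm F V → Prop} {M N : Multiset (AnyTerm F V)}
    (hM : M ≠ 0) (h : ∀ y ∈ N, ∃ x ∈ M, R x y) : MulExt R M N :=
  ⟨0, M, 0, N, (zero_add _).symm, (zero_add _).symm, .zero, hM, h⟩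

theorem MulExt.add_left {R : AnyTerm F V → AnyTerm F V → Prop} {M N P Q : Multiset (AnyTerm F V)}
    (hPQ : Multiset.Rel ACEq P Q) (h : MulExt R M N) : MulExt R (P + M) (Q + N) := by
  obtain ⟨S₁, S₂, T₁, T₂, rfl, rfl, h₁, h₂, h₃⟩ := h
  exact ⟨P + S₁, S₂, Q + T₁, T₂, (add_assoc _ _ _).symm, (add_assoc _ _ _).symm, hPQ.add h₁, h₂, h₃⟩

theorem mulExtEq_singleton_iff {R : AnyTerm F V → AnyTerm F V → Prop}
    {M : Multiset (AnyTerm F V)} {t : AnyTerm F V} :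
    MulExtEq R M {t} ↔ ∃ x ∈ M, R x t ∨ ACEq x t := by
  constructor
  · rintro (h | h)
    · exact h.exists_dominating (Multiset.mem_singleton_self t)
    · obtain ⟨x, hx, hxt⟩ := rel_exists_of_mem_right h (Multiset.mem_singleton_self t)
      exact ⟨x, hx, .inr hxt⟩
  · rintro ⟨x, hx, h | h⟩
    · refine .inl (.of_forall (fun h0 => by simp [h0] at hx) fun y hy => ⟨x, hx, ?_⟩)
      rwa [Multiset.mem_singleton.1 hy]
    · obtain ⟨M, rfl⟩ := Multiset.exists_cons_of_mem hx
      rcases eq_or_ne M 0 with rfl | hM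
      · exact .inr (rel_singleton h)
      · exact .inl ⟨{x}, M, {t}, 0, rfl, rfl, rel_singleton h, hM, by simp⟩

theorem mulExt_singleton_iff {R : AnyTerm F V → AnyTerm F V → Prop} {s : AnyTerm F V}
    {N : Multiset (AnyTerm F V)} : MulExt R {s} N ↔ ∀ y ∈ N, R s y := by
  constructor
  · rintro ⟨S₁, S₂, T₁, T₂, hM, hN, h₁, h₂, h₃⟩ y hy
    -- The nonempty part `S₂` takes up all of `{s}`.
    have hc := congrArg Multiset.card hM
    rw [Multiset.card_add, Multiset.card_singleton] at hc
    have := Multiset.card_pos.2 h₂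
    obtain rfl : S₁ = 0 := Multiset.card_eq_zero.1 (by omega)
    rw [Multiset.rel_zero_left] at h₁
    rw [zero_add] at hM
    rw [hN, h₁, zero_add] at hy
    obtain ⟨x, hx, hxy⟩ := h₃ y hy
    rw [← hM, Multiset.mem_singleton] at hx
    exact hx ▸ hxy
  · exact fun h => .of_forall (by simp) fun y hy => ⟨s, by simp, h y hy⟩

/-- Composition with `=_AC` on both sides, where `R'` contains the composition of `R` with
`=_AC`. -/
theorem MulExt.congr {R R' : AnyTerm F V → AnyTerm F V → Prop}
    (hR : ∀ s s' t' t, ACEq s s' → R s' t' → ACEq t' t → R' s t)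
    {M M' N' N : Multiset (AnyTerm F V)} (hM : Multiset.Rel ACEq M M') (h : MulExt R M' N')
    (hN : Multiset.Rel ACEq N' N) : MulExt R' M N := by
  obtain ⟨S₁, S₂, T₁, T₂, rfl, rfl, h₁, h₂, h₃⟩ := h
  obtain ⟨M₁, M₂, hM₁, hM₂, rfl⟩ := Multiset.rel_add_right.1 hM
  obtain ⟨N₁, N₂, hN₁, hN₂, rfl⟩ := Multiset.rel_add_left.1 hN
  refine ⟨M₁, M₂, N₁, N₂, rfl, rfl, rel_trans hM₁ (rel_trans h₁ hN₁), ?_, fun t ht => ?_⟩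
  · rintro rfl
    exact h₂ (Multiset.rel_zero_left.1 hM₂)
  · obtain ⟨t', ht', htt'⟩ := rel_exists_of_mem_right hN₂ ht
    obtain ⟨s', hs', hst'⟩ := h₃ t' ht'
    obtain ⟨s, hs, hss'⟩ := rel_exists_of_mem_right hM₂ hs'
    exact ⟨s, hs, hR _ _ _ _ hss' hst' htt'⟩

/-- Riesz refinement for multisets. -/
theorem exists_refinement {α : Type*} {A B C D : Multiset α} (h : A + B = C + D) :
    ∃ P Q P' Q', A = P + Q ∧ B = P' + Q' ∧ C = P + P' ∧ D = Q + Q' := by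
  classical
  refine ⟨A ∩ C, A - C, C - A, D - (A - C), ?_, ?_, ?_, ?_⟩
  all_goals
    ext x
    have := congrArg (Multiset.count x) h
    simp only [Multiset.count_add, Multiset.count_inter, Multiset.count_sub] at this ⊢
    omega

/-- Transitivity of the multiset extension only needs transitivity at the elements of the three
multisets, so that it can be used in an induction. -/
theorem MulExt.trans {R : AnyTerm F V → AnyTerm F V → Prop} (hR : IsACCompatible R)
    {M N P : Multiset (AnyTerm F V)}
    (htrans : ∀ x ∈ M, ∀ y ∈ N, ∀ z ∈ P, R x y → R y z → R x z)
    (h : MulExt R M N) (h' : MulExt R N P) : MulExt R M P := by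
  obtain ⟨S₁, S₂, T₁, T₂, rfl, rfl, h₁, h₂, h₃⟩ := h
  obtain ⟨T₁', T₂', U₁, U₂, hT, rfl, h₁', -, h₃'⟩ := h'
  obtain ⟨A, B, C, D, rfl, rfl, rfl, rfl⟩ := exists_refinement hT
  obtain ⟨SA, SB, hSA, hSB, rfl⟩ := Multiset.rel_add_right.1 h₁
  obtain ⟨UA, UC, hUA, hUC, rfl⟩ := Multiset.rel_add_left.1 h₁'
  refine ⟨SA, SB + S₂, UA, UC + U₂, by rw [add_assoc], by rw [add_assoc], rel_trans hSA hUA, ?_, ?_⟩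
  · intro h0
    exact h₂ (add_eq_zero.1 h0).2
  · intro z hz
    rcases Multiset.mem_add.1 hz with hz | hz
    · obtain ⟨y, hy, hyz⟩ := rel_exists_of_mem_right hUC hz
      obtain ⟨x, hx, hxy⟩ := h₃ y (Multiset.mem_add.2 (.inl hy))
      exact ⟨x, Multiset.mem_add.2 (.inr hx), hR _ _ _ _ (.refl x) hxy hyz⟩
    · obtain ⟨y, hy, hyz⟩ := h₃' z hz
      rcases Multiset.mem_add.1 hy with hy | hy
      · obtain ⟨x, hx, hxy⟩ := rel_exists_of_mem_right hSB hy
        exact ⟨x, Multiset.mem_add.2 (.inl hx), hR _ _ _ _ hxy hyz (.refl z)⟩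
      · obtain ⟨x, hx, hxy⟩ := h₃ y (Multiset.mem_add.2 (.inr hy))
        refine ⟨x, Multiset.mem_add.2 (.inr hx), htrans x ?_ y ?_ z ?_ hxy hyz⟩ <;>
          simp [hx, hy, hz]

theorem exists_maximal {α : Type*} {R : α → α → Prop} (htrans : ∀ x y z, R x y → R y z → R x z)
    {M : Multiset α} (hirr : ∀ x ∈ M, ¬ R x x) (hM : M ≠ 0) : ∃ m ∈ M, ∀ x ∈ M, ¬ R x m := by
  induction M using Multiset.induction_on with
  | empty => exact absurd rfl hM
  | cons a M ih =>
    have ha := hirr a (Multiset.mem_cons_self a M)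
    rcases eq_or_ne M 0 with rfl | hM'
    · exact ⟨a, by simp, by simpa using ha⟩
    · obtain ⟨m, hm, hmax⟩ := ih (fun x hx => hirr x (Multiset.mem_cons_of_mem hx)) hM'
      by_cases ham : R a m
      · refine ⟨a, Multiset.mem_cons_self a M, fun x hx hxa => ?_⟩
        rcases Multiset.mem_cons.1 hx with rfl | hx
        · exact ha hxa
        · exact hmax x hx (htrans _ _ _ hxa ham)
      · refine ⟨m, Multiset.mem_cons_of_mem hm, fun x hx => ?_⟩
        rcases Multiset.mem_cons.1 hx with rfl | hx
        · exact ham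
        · exact hmax x hx

/-- Cancellation for the multiset extension of `=_AC`; it is inherited from multisets over the
quotient by `=_AC`. -/
theorem rel_add_cancel {A B C D : Multiset (AnyTerm F V)} (h : Multiset.Rel ACEq (A + B) (C + D))
    (h' : Multiset.Rel ACEq A C) : Multiset.Rel ACEq B D := by
  have key : ∀ {M N : Multiset (AnyTerm F V)}, Multiset.Rel ACEq M N ↔
      M.map (Quot.mk ACStep) = N.map (Quot.mk ACStep) := by
    intro M N
    rw [← Multiset.rel_eq, Multiset.rel_map]
    have : (fun a b : AnyTerm F V => Quot.mk ACStep a = Quot.mk ACStep b) = ACEq := by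
      funext a b
      exact propext Quot.eq
    rw [this]
  rw [key] at h h' ⊢
  rwa [Multiset.map_add, Multiset.map_add, h', add_right_inj] at h

theorem MulExt.irrefl {R : AnyTerm F V → AnyTerm F V → Prop} (hR : IsACCompatible R)
    (htrans : ∀ x y z, R x y → R y z → R x z) {M : Multiset (AnyTerm F V)}
    (hirr : ∀ x ∈ M, ¬ R x x) : ¬ MulExt R M M := by
  rintro ⟨S₁, S₂, T₁, T₂, hM, hN, h₁, h₂, h₃⟩
  have h : Multiset.Rel ACEq S₂ T₂ := rel_add_cancel (hM ▸ hN ▸ rel_refl M) h₁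
  obtain ⟨m, hm, hmax⟩ := exists_maximal htrans
    (fun x hx => hirr x (hM ▸ Multiset.mem_add.2 (.inr hx))) h₂
  -- `m` is AC-equal to an element of `T₂`, which is dominated by an element of `S₂`.
  obtain ⟨t, ht, hmt⟩ := Multiset.exists_mem_of_rel_of_mem h hm
  obtain ⟨s, hs, hst⟩ := h₃ t ht
  exact hmax s hs (hR _ _ _ _ (.refl s) hst hmt.symm)

/-! ### AC-MPO as a strict order -/

/-- The three cases of AC-MPO in terms of `root` and `topArgs`, with the singleton multisets
eliminated. -/
theorem acmpoStep_iff {gt : F.Sym → F.Sym → Prop} {R : AnyTerm F V → AnyTerm F V → Prop}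
    {s t : AnyTerm F V} : ACMPOStep gt R s t ↔ ∃ f, root s = some f ∧
      ((∃ x ∈ topArgs s, R x t ∨ ACEq x t) ∨
        (∃ g, root t = some g ∧ gt f g ∧ ∀ y ∈ topArgs t, R s y) ∨
        (root t = some f ∧ MulExt R (topArgs s) (topArgs t))) := by
  constructor
  · intro h
    cases h with
    | subterm f ss t h => exact ⟨f, rfl, .inl (mulExtEq_singleton_iff.1 h)⟩
    | prec f g ss ts hfg h =>
      exact ⟨f, rfl, .inr (.inl ⟨g, rfl, hfg,
        mulExt_singleton_iff.1 h⟩)⟩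
    | root f ss ts h => exact ⟨f, rfl, .inr (.inr ⟨rfl, h⟩)⟩
  · rintro ⟨f, hf, h⟩
    obtain ⟨_, x | ⟨f', ss⟩⟩ := s
    · cases hf
    obtain rfl : f' = f := Option.some.inj hf
    rcases h with h | ⟨g, hg, hfg, h⟩ | ⟨ht, h⟩
    · exact .subterm _ _ _ (mulExtEq_singleton_iff.2 h)
    · obtain ⟨_, x | ⟨g', ts⟩⟩ := t
      · cases hg
      obtain rfl : g' = g := Option.some.inj hg
      exact .prec _ _ _ _ hfg (mulExt_singleton_iff.2 h)
    · obtain ⟨_, x | ⟨g', ts⟩⟩ := t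
      · cases ht
      obtain rfl : g' = f' := Option.some.inj ht
      exact .root _ _ _ h

theorem acmpo_iff_step {gt : F.Sym → F.Sym → Prop} {s t : AnyTerm F V} :
    ACMPO gt s t ↔ ACMPOStep gt (ACMPO gt) s t := by
  have h := OrderHom.map_lfp (⟨ACMPOStep gt, ACMPOStep.monotone gt⟩ :
    (AnyTerm F V → AnyTerm F V → Prop) →o (AnyTerm F V → AnyTerm F V → Prop))
  exact (iff_of_eq (congrFun (congrFun h s) t)).symm

theorem acmpo_iff {gt : F.Sym → F.Sym → Prop} {s t : AnyTerm F V} :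
    ACMPO gt s t ↔ ∃ f, root s = some f ∧
      ((∃ x ∈ topArgs s, ACMPO gt x t ∨ ACEq x t) ∨
        (∃ g, root t = some g ∧ gt f g ∧ ∀ y ∈ topArgs t, ACMPO gt s y) ∨
        (root t = some f ∧ MulExt (ACMPO gt) (topArgs s) (topArgs t))) :=
  acmpo_iff_step.trans acmpoStep_iff

/-- The induction principle of AC-MPO as a least fixed point. -/
theorem ACMPO.induct {gt : F.Sym → F.Sym → Prop} {R : AnyTerm F V → AnyTerm F V → Prop}
    (hR : ∀ s t, ACMPOStep gt R s t → R s t) {s t : AnyTerm F V} (h : ACMPO gt s t) : R s t :=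
  OrderHom.lfp_le (⟨ACMPOStep gt, ACMPOStep.monotone gt⟩ :
    (AnyTerm F V → AnyTerm F V → Prop) →o (AnyTerm F V → AnyTerm F V → Prop))
    (a := R) (fun s t => hR s t) s t h

theorem ACMPO.mono_prec {gt gt' : F.Sym → F.Sym → Prop} (h : ∀ f g, gt f g → gt' f g)
    {s t : AnyTerm F V} (hst : ACMPO gt s t) : ACMPO gt' s t := by
  refine hst.induct (R := ACMPO gt') fun s t hst => acmpo_iff_step.2 ?_
  cases hst with
  | subterm f ss t h' => exact .subterm f ss t h'
  | prec f g ss ts hfg h' => exact .prec f g ss ts (h f g hfg) h'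
  | root f ss ts h' => exact .root f ss ts h'

variable {gt : F.Sym → F.Sym → Prop}

theorem exists_root_of_mem_topArgs {s x : AnyTerm F V} (hx : x ∈ topArgs s) :
    ∃ f, root s = some f := by
  obtain ⟨_, y | ⟨f, ss⟩⟩ := s
  · simp [topArgs] at hx
  · exact ⟨f, rfl⟩

theorem ACMPO.of_mem_topArgs {s t x : AnyTerm F V} (hx : x ∈ topArgs s)
    (h : ACMPO gt x t ∨ ACEq x t) : ACMPO gt s t := by
  obtain ⟨f, hf⟩ := exists_root_of_mem_topArgs hx
  exact acmpo_iff.2 ⟨f, hf, .inl ⟨x, hx, h⟩⟩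

theorem isACCompatible_acmpo : IsACCompatible (ACMPO (V := V) gt) := by
  intro s s' t' t hs h ht
  refine ACMPO.induct (gt := gt)
    (R := fun s' t' => ∀ s t, ACEq s s' → ACEq t' t → ACMPO gt s t) ?_ h s t hs ht
  intro s' t' h s t hs ht
  obtain ⟨hroot_s, hargs_s⟩ := hs.root_topArgs
  obtain ⟨hroot_t, hargs_t⟩ := ht.root_topArgs
  obtain ⟨f, hf, h⟩ := acmpoStep_iff.1 h
  refine acmpo_iff.2 ⟨f, hroot_s.trans hf, ?_⟩
  rcases h with ⟨x', hx', h⟩ | ⟨g, hg, hfg, h⟩ | ⟨hg, h⟩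
  · obtain ⟨x, hx, hxx'⟩ := rel_exists_of_mem_right hargs_s hx'
    exact .inl ⟨x, hx, h.imp (fun h => h _ _ hxx' ht) fun h => hxx'.trans (h.trans ht)⟩
  · refine .inr (.inl ⟨g, hroot_t ▸ hg, hfg, fun y hy => ?_⟩)
    obtain ⟨y', hy', hyy'⟩ := rel_exists_of_mem_right hargs_t hy
    exact h y' hy' _ _ hs hyy'
  · exact .inr (.inr ⟨hroot_t ▸ hg,
      h.congr (fun a a' b' b ha hab hb => hab a b ha hb) hargs_s hargs_t⟩)

theorem ACMPO.congr_right {s t u : AnyTerm F V} (h : ACMPO gt s t) (h' : ACEq t u) :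
    ACMPO gt s u :=
  isACCompatible_acmpo _ _ _ _ (.refl s) h h'

theorem ACMPO.congr_left {s t u : AnyTerm F V} (h : ACEq s t) (h' : ACMPO gt t u) :
    ACMPO gt s u :=
  isACCompatible_acmpo _ _ _ _ h h' (.refl u)

theorem ACMPO.trans (hgt : IsStrictOrder F.Sym gt) {s t u : AnyTerm F V} (h : ACMPO gt s t)
    (h' : ACMPO gt t u) : ACMPO gt s u := by
  induction hn : s.2.size + t.2.size + u.2.size using Nat.strong_induction_on
    generalizing s t u with
  | _ n ih =>
  subst hn
  obtain ⟨f, hf, hs⟩ := acmpo_iff.1 h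
  obtain ⟨g, hg, ht⟩ := acmpo_iff.1 h'
  -- The comparisons of an argument of one of the terms follow from the induction hypothesis.
  have hleft : ∀ x ∈ topArgs s, ACMPO gt x t → ACMPO gt x u := fun x hx hxt =>
    ih _ (by have := size_lt_of_mem_topArgs hx; omega) hxt h' rfl
  have hright : ∀ y ∈ topArgs u, ACMPO gt t y → ACMPO gt s y := fun y hy hty =>
    ih _ (by have := size_lt_of_mem_topArgs hy; omega) h hty rfl
  have hmid : ∀ y ∈ topArgs t, ACMPO gt s y → ACMPO gt y u ∨ ACEq y u → ACMPO gt s u := by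
    rintro y hy hsy (hyu | hyu)
    · exact ih _ (by have := size_lt_of_mem_topArgs hy; omega) hsy hyu rfl
    · exact hsy.congr_right hyu
  rcases hs with ⟨x, hx, hxt | hxt⟩ | ⟨g', hg', hfg, hs⟩ | ⟨hft, hs⟩
  · exact .of_mem_topArgs hx (.inl (hleft x hx hxt))
  · exact .of_mem_topArgs hx (.inl (.congr_left hxt h'))
  · obtain rfl : g' = g := Option.some.inj (hg'.symm.trans hg)
    rcases ht with ⟨y, hy, hyu⟩ | ⟨k, hk, hgk, ht⟩ | ⟨hgu, ht⟩
    · exact hmid y hy (hs y hy) hyu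
    · exact acmpo_iff.2 ⟨f, hf, .inr (.inl ⟨k, hk, hgt.trans _ _ _ hfg hgk,
        fun y hy => hright y hy (ht y hy)⟩)⟩
    · refine acmpo_iff.2 ⟨f, hf, .inr (.inl ⟨g', hgu, hfg, fun y hy => hright y hy ?_⟩)⟩
      obtain ⟨x, hx, hxy⟩ := ht.exists_dominating hy
      exact .of_mem_topArgs hx hxy
  · obtain rfl : f = g := Option.some.inj (hft.symm.trans hg)
    rcases ht with ⟨y, hy, hyu⟩ | ⟨k, hk, hgk, ht⟩ | ⟨hgu, ht⟩
    · obtain ⟨x, hx, hxy⟩ := hs.exists_dominating hy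
      exact hmid y hy (.of_mem_topArgs hx hxy) hyu
    · exact acmpo_iff.2 ⟨f, hf, .inr (.inl ⟨k, hk, hgk, fun y hy => hright y hy (ht y hy)⟩)⟩
    · refine acmpo_iff.2 ⟨f, hf, .inr (.inr ⟨hgu, hs.trans isACCompatible_acmpo ?_ ht⟩)⟩
      intro x hx y hy z hz hxy hyz
      refine ih _ ?_ hxy hyz rfl
      have := size_lt_of_mem_topArgs hx
      have := size_lt_of_mem_topArgs hy
      have := size_lt_of_mem_topArgs hz
      omega

theorem ACMPO.irrefl (hgt : IsStrictOrder F.Sym gt) (s : AnyTerm F V) : ¬ ACMPO gt s s := by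
  induction hn : s.2.size using Nat.strong_induction_on generalizing s with
  | _ n ih =>
  subst hn
  have hirr : ∀ x ∈ topArgs s, ¬ ACMPO gt x x := fun x hx =>
    ih _ (size_lt_of_mem_topArgs hx) x rfl
  intro h
  obtain ⟨f, hf, h⟩ := acmpo_iff.1 h
  rcases h with ⟨x, hx, h | h⟩ | ⟨g, hg, hfg, -⟩ | ⟨-, h⟩
  · exact hirr x hx (h.trans hgt (.of_mem_topArgs hx (.inr (.refl x))))
  · exact not_acEq_of_mem_topArgs hx h
  · obtain rfl : f = g := Option.some.inj (hf.symm.trans hg)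
    exact hgt.irrefl f hfg
  · exact MulExt.irrefl isACCompatible_acmpo (fun _ _ _ h h' => h.trans hgt h') hirr h

theorem ACMPO.of_immediateSubterm {t u : AnyTerm F V} (h : ImmediateSubterm t u) :
    ACMPO gt t u := by
  classical
  obtain ⟨f, args, i⟩ := h
  have hsum : topArgs (Term.app f args).any =
      flat f (args i) + ∑ j ∈ Finset.univ.erase i, flat f (args j) :=
    (Finset.add_sum_erase _ _ (Finset.mem_univ i)).symm
  by_cases hi : root (args i).any = some f ∧ f ∈ F.AC
  · have hflat : flat f (args i) = topArgs (args i).any := flat_eq_topArgs hi.2 hi.1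
    refine acmpo_iff.2 ⟨f, rfl, .inr (.inr ⟨hi.1, ?_⟩)⟩
    refine ⟨flat f (args i), _, topArgs (args i).any, 0, hsum, (add_zero _).symm,
      hflat ▸ rel_refl _, ?_, by simp⟩
    -- An AC symbol is binary, so that there is another argument.
    have : Nontrivial (Fin (F.arity f)) := Fin.nontrivial_iff_two_le.2 (F.ac_arity f hi.2).ge
    obtain ⟨j, hj⟩ := exists_ne i
    intro h0
    exact flat_ne_zero f (args j) (Finset.sum_eq_zero_iff.1 h0 j (by simp [hj]))
  · refine .of_mem_topArgs (x := (args i).any) ?_ (.inr (.refl _))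
    rw [hsum, show flat f (args i) = {(args i).any} from flat_eq_singleton hi]
    simp

theorem ACMPO.of_subterm (hgt : IsStrictOrder F.Sym gt) {t u : AnyTerm F V}
    (h : Relation.TransGen ImmediateSubterm t u) : ACMPO gt t u := by
  induction h with
  | single h => exact .of_immediateSubterm h
  | tail _ h ih => exact ih.trans hgt (.of_immediateSubterm h)

/-- A term that dominates `t` dominates the elements of every flattening of `t`. -/
theorem ACMPO.of_mem_flat (hgt : IsStrictOrder F.Sym gt) {f : F.Sym} {s t x : AnyTerm F V}
    (h : ACMPO gt s t) (hx : x ∈ flat f t.2) : ACMPO gt s x := by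
  rcases Relation.reflTransGen_iff_eq_or_transGen.1 (subterm_of_mem_flat hx) with rfl | hx
  · exact h
  · exact h.trans hgt (.of_subterm hgt hx)

/-! ### Closure under contexts -/

/-- Flattening is monotone. This is where minimality of the AC symbols is needed: it excludes that
`s` has the AC root `f` and dominates `t` because of the precedence. -/
theorem ACMPO.mulExt_flat (hgt : IsStrictOrder F.Sym gt) (hmin : ∀ f ∈ F.AC, ∀ g, ¬ gt f g)
    (f : F.Sym) {s t : AnyTerm F V} (h : ACMPO gt s t) :
    MulExt (ACMPO gt) (flat f s.2) (flat f t.2) := by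
  by_cases hs : root s = some f ∧ f ∈ F.AC
  · obtain ⟨hs, hf⟩ := hs
    rw [flat_eq_topArgs hf hs]
    obtain ⟨f', hf', h⟩ := acmpo_iff.1 h
    obtain rfl : f = f' := Option.some.inj (hs.symm.trans hf')
    rcases h with ⟨x, hx, h | h⟩ | ⟨g, -, hfg, -⟩ | ⟨ht, h⟩
    · exact .of_forall (fun h0 => by simp [h0] at hx) fun y hy => ⟨x, hx, h.of_mem_flat hgt hy⟩
    · have hxt := h.rel_flat f
      rw [flat_of_mem_topArgs hs hx] at hxt
      have hcard := two_le_card_topArgs hf hs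
      obtain ⟨M, hM⟩ := Multiset.exists_cons_of_mem hx
      refine ⟨{x}, M, flat f t.2, 0, hM, (add_zero _).symm, hxt, ?_, by simp⟩
      rintro rfl
      simp [hM] at hcard
    · exact absurd hfg (hmin f hf g)
    · rwa [flat_eq_topArgs hf ht]
  · rw [flat_eq_singleton hs]
    exact .of_forall (by simp) fun y hy => ⟨s, by simp, h.of_mem_flat hgt hy⟩

theorem closedUnderContexts_acmpo (hgt : IsStrictOrder F.Sym gt)
    (hmin : ∀ f ∈ F.AC, ∀ g, ¬ gt f g) : ClosedUnderContexts (ACMPO (V := V) gt) := by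
  classical
  intro s s' C a b h
  induction C with
  | hole => exact h
  | app f i args C ih =>
    refine acmpo_iff.2 ⟨f, rfl, .inr (.inr ⟨rfl, ?_⟩)⟩
    simp only [Ctx.fill, topArgs, topFlat]
    rw [← Finset.sum_erase_add _ _ (Finset.mem_univ i),
      ← Finset.sum_erase_add _ _ (Finset.mem_univ i)]
    refine .add_left (rel_sum _ _ _ fun j hj => ?_) ?_
    · simpa [Finset.ne_of_mem_erase hj] using rel_refl _
    · simpa using ih.mulExt_flat hgt hmin f

/-! ### Closure under substitutions -/

/-- Application of a substitution to a context. -/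
def Ctx.subst (σ : Substitution F V) {s : S} : {s' : S} → Ctx F V s s' → Ctx F V s s'
  | _, .hole => .hole
  | _, .app f i args C => .app f i (fun j h => (args j h).subst σ) (C.subst σ)

/-- Application of a substitution to a term of arbitrary sort. -/
abbrev substAny (σ : Substitution F V) (t : AnyTerm F V) : AnyTerm F V :=
  (t.2.subst σ).any

variable (σ : Substitution F V)

theorem subst_cast {s s' : S} (h : s = s') (t : Term F V s) :
    (h ▸ t : Term F V s').subst σ = h ▸ t.subst σ := by
  subst h; rfl

theorem subst_fill {s s' : S} (C : Ctx F V s s') (t : Term F V s) :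
    (C.fill t).subst σ = (C.subst σ).fill (t.subst σ) := by
  induction C with
  | hole => rfl
  | app f i args C ih =>
    simp only [Ctx.fill, Ctx.subst, Term.subst]
    congr 1
    funext j
    by_cases hj : j = i
    · subst hj
      simpa using ih
    · simp [hj]

theorem subst_acApp (f : F.Sym) (hf : f ∈ F.AC) (a b : Term F V (F.cod f)) :
    (acApp f hf a b).subst σ = acApp f hf (a.subst σ) (b.subst σ) := by
  simp only [acApp, Term.subst, subst_cast, apply_ite (Term.subst σ)]

theorem ACEq.subst {s t : AnyTerm F V} (h : ACEq s t) : ACEq (substAny σ s) (substAny σ t) := by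
  induction h with
  | rel s t h =>
    obtain ⟨C, a, b, h⟩ := h
    simp only [substAny, subst_fill]
    refine .rel _ _ ⟨_, _, _, ?_⟩
    cases h with
    | assoc f hf a b c => simpa only [subst_acApp] using .assoc f hf _ _ _
    | comm f hf a b => simpa only [subst_acApp] using .comm f hf _ _
  | refl t => exact .refl _
  | symm s t _ ih => exact ih.symm
  | trans s t u _ _ ih ih' => exact ih.trans ih'

theorem subterm_subst {t u : AnyTerm F V} (h : Relation.TransGen ImmediateSubterm t u) :
    Relation.TransGen ImmediateSubterm (substAny σ t) (substAny σ u) := by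
  refine h.lift (substAny σ) fun t u h => ?_
  obtain ⟨f, args, i⟩ := h
  exact .arg f (fun i => (args i).subst σ) i

theorem sum_bind {α β ι : Type*} (s : Finset ι) (M : ι → Multiset α) (f : α → Multiset β) :
    (∑ i ∈ s, M i).bind f = ∑ i ∈ s, (M i).bind f := by
  classical
  induction s using Finset.induction_on with
  | empty => simp
  | insert a s ha ih => rw [Finset.sum_insert ha, Finset.sum_insert ha, Multiset.add_bind, ih]

theorem flat_subst (f : F.Sym) {s : S} (t : Term F V s) :
    flat f (t.subst σ) = (flat f t).bind fun x => flat f (substAny σ x).2 := by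
  induction t with
  | var x =>
    rw [flat, Multiset.singleton_bind]
  | app g args ih =>
    by_cases hg : g = f ∧ f ∈ F.AC
    · simp only [Term.subst, flat, if_pos hg, sum_bind, ih]
    · simp only [flat, if_neg hg, Multiset.singleton_bind]

theorem root_subst {f : F.Sym} {t : AnyTerm F V} (h : root t = some f) :
    root (substAny σ t) = some f := by
  obtain ⟨_, x | ⟨g, args⟩⟩ := t
  · cases h
  · exact h

theorem topArgs_subst {f : F.Sym} {t : AnyTerm F V} (h : root t = some f) :
    topArgs (substAny σ t) = (topArgs t).bind fun x => flat f (substAny σ x).2 := by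
  obtain ⟨_, x | ⟨g, args⟩⟩ := t
  · cases h
  · obtain rfl : g = f := Option.some.inj h
    simp only [topArgs, topFlat, sum_bind, ← flat_subst, substAny, Term.subst]

theorem flat_subst_of_root {f g : F.Sym} {t : AnyTerm F V} (hg : root t = some g)
    (h : flat f t.2 = {t}) : flat f (substAny σ t).2 = {substAny σ t} := by
  refine flat_eq_singleton fun h' => not_root_of_flat_eq_singleton h ⟨?_, h'.2⟩
  rw [hg, ← h'.1, root_subst σ hg]

/-- A variable argument may turn into a term with the same AC root and then gets flattened. Only
arguments that are matched modulo AC or that are dominated can be variables; a dominating argument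
is not, so that its instance is still a single element, which dominates all elements of the
flattenings of the arguments below it. -/
theorem closedUnderSubstitutions_acmpo (hgt : IsStrictOrder F.Sym gt) :
    ClosedUnderSubstitutions (ACMPO (V := V) gt) := by
  intro σ s s' a b h
  refine (ACMPO.induct (gt := gt)
    (R := fun s t => ACMPO gt s t ∧ ACMPO gt (substAny σ s) (substAny σ t)) ?_ h).2
  intro s t h
  refine ⟨acmpo_iff_step.2 (ACMPOStep.monotone gt (fun _ _ h => h.1) _ _ h), ?_⟩
  obtain ⟨f, hf, h⟩ := acmpoStep_iff.1 h
  rcases h with ⟨x, hx, h⟩ | ⟨g, hg, hfg, h⟩ | ⟨ht, S₁, S₂, T₁, T₂, hM, hN, h₁, h₂, h₃⟩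
  · have hsx : ACMPO gt (substAny σ s) (substAny σ x) :=
      .of_subterm hgt (subterm_subst σ (subterm_of_mem_topArgs hx))
    exact h.elim (fun h => hsx.trans hgt h.2) fun h => hsx.congr_right (h.subst σ)
  · refine acmpo_iff.2 ⟨f, root_subst σ hf, .inr (.inl ⟨g, root_subst σ hg, hfg, fun y hy => ?_⟩)⟩
    rw [topArgs_subst σ hg] at hy
    obtain ⟨x, hx, hy⟩ := Multiset.mem_bind.1 hy
    exact (h x hx).2.of_mem_flat hgt hy
  · refine acmpo_iff.2 ⟨f, root_subst σ hf, .inr (.inr ⟨root_subst σ ht, ?_⟩)⟩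
    rw [topArgs_subst σ hf, topArgs_subst σ ht]
    have hS : ∀ x ∈ S₂, flat f x.2 = {x} := fun x hx =>
      flat_of_mem_topArgs hf (hM ▸ Multiset.mem_add.2 (.inr hx))
    rw [hM, hN, Multiset.add_bind, Multiset.add_bind]
    refine ⟨_, _, _, _, rfl, rfl, Multiset.rel_bind (fun x y h => (h.subst σ).rel_flat f) h₁, ?_, ?_⟩
    · obtain ⟨x, hx⟩ := Multiset.exists_mem_of_ne_zero h₂
      obtain ⟨y, hy⟩ := Multiset.exists_mem_of_ne_zero (flat_ne_zero f (substAny σ x).2)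
      intro h0
      have : y ∈ S₂.bind fun x => flat f (substAny σ x).2 := Multiset.mem_bind.2 ⟨x, hx, hy⟩
      rw [h0] at this
      exact Multiset.notMem_zero _ this
    · intro z hz
      obtain ⟨y, hy, hz⟩ := Multiset.mem_bind.1 hz
      obtain ⟨x, hx, hxy, hxy'⟩ := h₃ y hy
      refine ⟨substAny σ x, Multiset.mem_bind.2 ⟨x, hx, ?_⟩, hxy'.of_mem_flat hgt hz⟩
      -- As `x` dominates `y`, it is not a variable, so that its instance does not get flattened.
      obtain ⟨g, hg, -⟩ := acmpo_iff.1 hxy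
      rw [flat_subst_of_root σ hg (hS x hx)]
      simp

end ACRew

theorem mainTheorem5 {S : Type*} (F : ACRew.Signature S) (V : S → Type*)
    (gt : F.Sym → F.Sym → Prop) (hgt : IsStrictOrder F.Sym gt)
    (hmin : ∀ f ∈ F.AC, ∀ g, ¬ gt f g) :
    ACRew.IsRewriteOrder (ACRew.ACMPO (V := V) gt) ∧
    ACRew.IsACCompatible (ACRew.ACMPO (V := V) gt) ∧
    ACRew.HasSubtermProperty (ACRew.ACMPO (V := V) gt) ∧
    (∀ gt' : F.Sym → F.Sym → Prop, IsStrictOrder F.Sym gt' → (∀ f g, gt f g → gt' f g) →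
      ∀ s t : ACRew.AnyTerm F V, ACRew.ACMPO gt s t → ACRew.ACMPO gt' s t) :=
  ⟨{ irrefl := ACRew.ACMPO.irrefl hgt
     trans := fun _ _ _ h h' => h.trans hgt h'
     closedUnderContexts := ACRew.closedUnderContexts_acmpo hgt hmin
     closedUnderSubstitutions := ACRew.closedUnderSubstitutions_acmpo hgt },
    ACRew.isACCompatible_acmpo,
    fun _ _ h => .of_subterm hgt h,
    fun _ _ h _ _ hst => hst.mono_prec h⟩
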